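/- Write elements of $\mathbb R^{10}$ as $(D,B,P,h)$ with $D,B,P\in\mathbb R^3$ and $h\in\mathbb R$. The Born–Infeld manifold is $$\mathcal M=\{(D,B,P,h)\in\mathbb R^3\times\mathbb R^3\times\mathbb R^3\times\mathbb R:\ P=D\wedge B,\ h=\sqrt{1+|D|^2+|B|^2+|P|^2}\},$$ where $\wedge$ is the vector product, and $\mathcal M^c$ denotes its convex hull. An open set in $\mathbb R^3$ has Lipschitz boundary if near each of its boundary points it is, in suitable Cartesian coordinates, the region strictly above the graph of a Lipschitz function of two variables. A function $f$ on $\Omega$ (taken up to equality almost everywhere) is piecewise constant if there are finitely or countably many mutually disjoint open sets $\Omega_i\subset\Omega$ with Lipschitz boundary such that $f$ is constant on each $\Omega_i$ and $|\Omega\setminus\bigcup_i\Omega_i|=0$. **Theorem 1.1.** Let $\Omega\subset\mathbb R^3$ be a bounded and open set with Lipschitz boundary, and let $L$ be a compact subset of the interior (in $\mathbb R^{10}$) of $\mathcal M^c$. Let $F=(D,B,P,h)\in L^\infty(\Omega;\mathbb R^{10})$ be piecewise constant, with $F(x)\in L$ for a.e. $x\in\Omega$ and $\operatorname{div}D=\operatorname{div}B=0$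 in $\mathcal D'(\Omega)$. Then there exists a sequence $V_j=(D_j,B_j,P_j,h_j)\in L^\infty(\Omega;\mathbb R^{10})$ such that, for every $j$, $\operatorname{div}D_j=\operatorname{div}B_j=0$ in $\mathcal D'(\Omega)$ and $V_j\in\mathcal M$ a.e. in $\Omega$, and such that $V_j\overset{*}{\rightharpoonup}F$ weakly-$*$ in $L^\infty(\Omega;\mathbb R^{10})$, that is, $\int_\Omega V_j\varphi\,dx\to\int_\Omega F\varphi\,dx$ for every $\varphi\in L^1(\Omega)$. -/

import Mathlib

open MeasureTheory Filter Topology Set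
open scoped ContDiff

/-- Euclidean space `ℝ³`. -/
abbrev E3 : Type := EuclideanSpace ℝ (Fin 3)

/-- The space `ℝ¹⁰ = ℝ³ × ℝ³ × ℝ³ × ℝ` of states `(D, B, P, h)`. -/
abbrev State : Type := E3 × E3 × E3 × ℝ

namespace State

/-- The component `D` of `(D, B, P, h)`. -/
def D (v : State) : E3 := v.1

/-- The component `B` of `(D, B, P, h)`. -/
def B (v : State) : E3 := v.2.1

/-- The component `P` of `(D, B, P, h)`. -/
def P (v : State) : E3 := v.2.2.1

/-- The component `h` of `(D, B, P, h)`. -/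
def h (v : State) : ℝ := v.2.2.2

end State

/-- The vector product `a ∧ b` of two vectors of `ℝ³`. -/
def wedge (a b : E3) : E3 := WithLp.toLp 2 (crossProduct a.ofLp b.ofLp)

/-- The Born-Infeld manifold: the set of all `(D, B, P, h)` with `P = D ∧ B` and
`h = √(1 + |D|² + |B|² + |P|²)`. -/
def bornInfeld : Set State :=
  {v | v.P = wedge v.D v.B ∧ v.h = Real.sqrt (1 + ‖v.D‖ ^ 2 + ‖v.B‖ ^ 2 + ‖v.P‖ ^ 2)}

/-- The set `Ω ⊆ ℝ³` has Lipschitz boundary: near each of its boundary points it is, in suitable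
Cartesian coordinates, the set of points that lie strictly above the graph of a Lipschitz function
of two variables. (A translation of the coordinates can be absorbed in `g`.) -/
def HasLipschitzBoundary (Ω : Set E3) : Prop :=
  ∀ x ∈ frontier Ω, ∃ (e : E3 ≃ₗᵢ[ℝ] E3) (K : NNReal) (g : EuclideanSpace ℝ (Fin 2) → ℝ)
    (U : Set E3), LipschitzWith K g ∧ IsOpen U ∧ x ∈ U ∧
      ∀ y ∈ U, (y ∈ Ω ↔ g !₂[e y 0, e y 1] < e y 2)

/-- The function `f`, taken up to equality almost everywhere on `Ω`, is piecewise constant: `Ω` is,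
up to a null set, the union of finitely or countably many mutually disjoint open sets with
Lipschitz boundary, on each of which `f` is constant. (Members of the sequence `A` may be empty,
so finite families are included.) -/
def PiecewiseConstantOn (f : E3 → State) (Ω : Set E3) : Prop :=
  ∃ A : ℕ → Set E3,
    (∀ i, IsOpen (A i) ∧ A i ⊆ Ω ∧ HasLipschitzBoundary (A i)) ∧
    (∀ i j, i ≠ j → Disjoint (A i) (A j)) ∧
    volume (Ω \ ⋃ i, A i) = 0 ∧
    ∀ i, ∃ c : State, ∀ᵐ x ∂(volume.restrict (A i)), f x = c

/-- `div u = 0` in the sense of distributions on `Ω`: one has `∫_Ω u · ∇φ dx = 0` for every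
`φ ∈ C_c^∞(Ω)`. Here `∇φ(x) · u(x)` is written as `fderiv ℝ φ x (u x)`. -/
def DivFreeOn (u : E3 → E3) (Ω : Set E3) : Prop :=
  ∀ φ : E3 → ℝ, ContDiff ℝ ∞ φ → HasCompactSupport φ → tsupport φ ⊆ Ω →
    ∫ x in Ω, fderiv ℝ φ x (u x) = 0

/-- Weak-star convergence `V j ⇀* F` in `L^∞(Ω; ℝ¹⁰) = L¹(Ω; ℝ¹⁰)*`, for functions in `L^∞`. As
`ℝ¹⁰` is finite dimensional it is enough to pair with scalar functions in `L¹(Ω)`; all components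
are then tested at once by a vector-valued integral. -/
def WeakStarTendsto (V : ℕ → E3 → State) (F : E3 → State) (Ω : Set E3) : Prop :=
  ∀ φ : E3 → ℝ, IntegrableOn φ Ω volume →
    Tendsto (fun j => ∫ x in Ω, φ x • V j x) atTop (𝓝 (∫ x in Ω, φ x • F x))

/-! The differential constraint acts only on `D` and `B`, while `P` and `h` are free apart from the
pointwise relations. Hence any two states can be laminated: for a jump `d` between them there is in
`ℝ³` a unit vector `ξ` orthogonal to both `d.D` and `d.B` (`exists_norm_eq_one_inner_eq_zero`), and
divergence-free fields may jump across planes normal to `ξ`.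

To localise a laminate in a bounded open set `O`, take a small Lipschitz potential `f` vanishing off
`O` with gradient `(1 - l) ξ` or `-l ξ` up to small measure (`exists_laminate`). The field `a + (∂_ξ
f) b - (∂_b f) ξ` is divergence free because mixed derivatives commute, equals `a` off `O`, and for
`b ⟂ ξ` takes the two laminate values on the two good sets. On the bad set `(D, B)` is still
bounded, so choosing `P` and `h` by the defining formulas puts the state on the manifold exactly; no
limiting construction is needed.

Replacing each of the two values by an approximation of it therefore approximates their convex
combination, with the same bound `C` (`convexCombo_mem_approximable`). So the approximable states
form a convex set containing a bounded part of the manifold, and the hulls of bounded parts exhaust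
compact subsets of the interior of `𝓜ᶜ`. It remains to glue over the countably many pieces of `F`
with summable errors (`exists_glue`) and to pass from Lipschitz to `L¹` test functions. -/

/-! ### The sawtooth profile. -/

/-- The periodic function of period `1` that vanishes on the integers, has slope `1 - l` on `(0, l)`
and slope `-l` on `(l, 1)`. -/
noncomputable def sawtooth (l s : ℝ) : ℝ := min ((1 - l) * Int.fract s) (l * (1 - Int.fract s))

/-- With `exists_sawtooth_eq` this presents the sawtooth as a minimum over `k` of convex functions
with slopes `1 - l` and `-l`, so the Lipschitz bound needs no comparison of different periods. -/
lemma sawtooth_le {l : ℝ} (hl : 0 ≤ l) (hl' : l ≤ 1) (s : ℝ) (k : ℤ) :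
    sawtooth l s ≤ max ((1 - l) * (s - k)) (-l * (s - k)) := by
  have hs : s - k = Int.fract s + ((⌊s⌋ - k : ℤ) : ℝ) := by
    push_cast
    linarith [Int.floor_add_fract s]
  rcases le_or_gt k ⌊s⌋ with h | h
  · have hj : (0 : ℝ) ≤ ((⌊s⌋ - k : ℤ) : ℝ) := by exact_mod_cast sub_nonneg.2 h
    refine (min_le_left _ _).trans (le_trans ?_ (le_max_left _ _))
    exact mul_le_mul_of_nonneg_left (by linarith) (by linarith)
  · have hj : ((⌊s⌋ - k : ℤ) : ℝ) ≤ -1 := by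
      have : ⌊s⌋ - k ≤ -1 := by omega
      exact_mod_cast this
    refine (min_le_right _ _).trans (le_trans ?_ (le_max_right _ _))
    rw [hs]
    nlinarith

lemma exists_sawtooth_eq (l s : ℝ) :
    ∃ k : ℤ, sawtooth l s = max ((1 - l) * (s - k)) (-l * (s - k)) := by
  have h0 := Int.fract_nonneg s
  have h1 := (Int.fract_lt_one s).le
  rcases le_total ((1 - l) * Int.fract s) (l * (1 - Int.fract s)) with h | h
  · refine ⟨⌊s⌋, ?_⟩
    rw [sawtooth, min_eq_left h, Int.self_sub_floor, max_eq_left]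
    nlinarith
  · refine ⟨⌊s⌋ + 1, ?_⟩
    have : s - ((⌊s⌋ + 1 : ℤ) : ℝ) = Int.fract s - 1 := by
      push_cast
      linarith [Int.floor_add_fract s]
    rw [sawtooth, min_eq_right h, this, max_eq_right]
    · ring
    · nlinarith

lemma lipschitzWith_sawtooth {l : ℝ} (hl : 0 ≤ l) (hl' : l ≤ 1) :
    LipschitzWith 1 (sawtooth l) := by
  refine LipschitzWith.of_le_add fun s t => ?_
  obtain ⟨k, hk⟩ := exists_sawtooth_eq l t
  rw [hk, Real.dist_eq]
  refine (sawtooth_le hl hl' s k).trans (max_le ?_ ?_)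
  · have h1 := le_max_left ((1 - l) * (t - k)) (-l * (t - k))
    nlinarith [le_abs_self (s - t), abs_nonneg (s - t)]
  · have h1 := le_max_right ((1 - l) * (t - k)) (-l * (t - k))
    nlinarith [neg_abs_le (s - t), abs_nonneg (s - t)]

lemma sawtooth_nonneg {l : ℝ} (hl : 0 ≤ l) (hl' : l ≤ 1) (s : ℝ) : 0 ≤ sawtooth l s :=
  le_min (mul_nonneg (by linarith) (Int.fract_nonneg s))
    (mul_nonneg hl (by linarith [Int.fract_lt_one s]))

lemma sawtooth_le_one {l : ℝ} (hl : 0 ≤ l) (s : ℝ) : sawtooth l s ≤ 1 :=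
  (min_le_left _ _).trans (by nlinarith [Int.fract_nonneg s, Int.fract_lt_one s])

lemma sawtooth_eq_of_mem_Ioo_left {l s : ℝ} (hl' : l ≤ 1) {k : ℤ} (h : (k : ℝ) < s)
    (h' : s < k + l) : sawtooth l s = (1 - l) * (s - k) := by
  have hf : ⌊s⌋ = k := Int.floor_eq_iff.2 ⟨h.le, by linarith⟩
  have hs : Int.fract s = s - k := by rw [← hf, Int.self_sub_floor]
  rw [sawtooth, hs, min_eq_left]
  nlinarith

lemma sawtooth_eq_of_mem_Ioo_right {l s : ℝ} (hl : 0 ≤ l) {k : ℤ} (h : k + l < s)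
    (h' : s < k + 1) : sawtooth l s = -l * (s - k - 1) := by
  have hf : ⌊s⌋ = k := Int.floor_eq_iff.2 ⟨by linarith, h'⟩
  have hs : Int.fract s = s - k := by rw [← hf, Int.self_sub_floor]
  rw [sawtooth, hs, min_eq_right]
  · ring
  · nlinarith

/-! ### Localised simple laminates. -/

lemma lineDeriv_eq_of_eventuallyEq_affine {f : E3 → ℝ} {x ξ : E3} {a b : ℝ}
    (h : f =ᶠ[𝓝 x] fun y => a * inner ℝ ξ y + b) (v : E3) :
    lineDeriv ℝ f x v = a * inner ℝ ξ v := by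
  rw [h.lineDeriv_eq]
  have : HasFDerivAt (fun y : E3 => a * inner ℝ ξ y + b) (a • innerSL ℝ ξ) x :=
    (((innerSL ℝ ξ).hasFDerivAt).const_mul a).add_const b
  rw [(this.hasLineDerivAt v).lineDeriv]
  simp

/-- Fermat's rule, where a derivative that does not exist counts as `0`. It covers the whole
complement of `O`, including a boundary of possibly positive measure. -/
lemma lineDeriv_eq_zero_of_forall_le {f : E3 → ℝ} {x : E3} (h : ∀ y, f x ≤ f y) (v : E3) :
    lineDeriv ℝ f x v = 0 := by
  refine IsLocalMin.deriv_eq_zero (Eventually.of_forall fun t => ?_)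
  simpa using h _

/-- The hyperplanes orthogonal to a nonzero vector are null sets. -/
lemma volume_inner_eq_const {ξ : E3} (hξ : ξ ≠ 0) (c : ℝ) :
    volume {x : E3 | inner ℝ ξ x = c} = 0 := by
  by_cases hne : ∃ p : E3, inner ℝ ξ p = c
  · obtain ⟨p, hp⟩ := hne
    let A : AffineSubspace ℝ E3 := AffineSubspace.mk' p (LinearMap.ker (innerSL ℝ ξ).toLinearMap)
    have hA : (A : Set E3) = {x : E3 | inner ℝ ξ x = c} := by
      ext x
      simp [A, AffineSubspace.mem_mk', inner_sub_right, hp, sub_eq_zero]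
    rw [← hA]
    refine Measure.addHaar_affineSubspace volume A fun h => hξ ?_
    have : p + ξ ∈ A := h ▸ AffineSubspace.mem_top ℝ E3 _
    simpa [A, AffineSubspace.mem_mk'] using this
  · have : {x : E3 | inner ℝ ξ x = c} = ∅ := eq_empty_of_forall_notMem fun x hx => hne ⟨x, hx⟩
    rw [this, measure_empty]

/-- For a bounded open set `O`, the points of `O` at distance at most `δ` from the complement have
small measure if `δ` is small. -/
lemma exists_volume_infDist_le {O : Set E3} (hO : IsOpen O) (hb : Bornology.IsBounded O)
    {ε : ℝ} (hε : 0 < ε) :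
    ∃ δ > 0, δ ≤ ε ∧ volume.real {x ∈ O | Metric.infDist x Oᶜ ≤ δ} ≤ ε := by
  let s : ℕ → Set E3 := fun n => {x ∈ O | Metric.infDist x Oᶜ ≤ 1 / ((n : ℝ) + 1)}
  have hfin : ∀ n, volume (s n) ≠ ⊤ := fun n =>
    ((measure_mono (fun x hx => hx.1)).trans_lt hb.measure_lt_top).ne
  -- The distance to an empty set would be `0` by convention.
  have hne : (Oᶜ).Nonempty := by
    rw [nonempty_compl]
    rintro rfl
    exact NormedSpace.unbounded_univ ℝ E3 hb
  have hinter : ⋂ n, s n = ∅ := by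
    refine eq_empty_of_forall_notMem fun x hx => ?_
    rw [mem_iInter] at hx
    have hxO : x ∉ Oᶜ := fun h => h (hx 0).1
    have hpos := (hO.isClosed_compl.notMem_iff_infDist_pos hne).1 hxO
    obtain ⟨n, hn⟩ := exists_nat_one_div_lt hpos
    exact absurd (hx n).2 (not_le.2 hn)
  have hanti : Antitone s := fun m n hmn x hx =>
    ⟨hx.1, hx.2.trans (Nat.one_div_le_one_div hmn)⟩
  have hmeas : ∀ n, NullMeasurableSet (s n) volume := fun n =>
    (hO.measurableSet.inter (measurableSet_le (Metric.continuous_infDist_pt _).measurable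
      measurable_const)).nullMeasurableSet
  have ht := tendsto_measure_iInter_atTop hmeas hanti ⟨0, hfin 0⟩
  rw [hinter, measure_empty] at ht
  have h1 := ht.eventually (ge_mem_nhds (ENNReal.ofReal_pos.2 hε))
  have h2 := tendsto_one_div_add_atTop_nhds_zero_nat.eventually (ge_mem_nhds hε)
  obtain ⟨n, hn, hn'⟩ := (h1.and h2).exists
  exact ⟨1 / ((n : ℝ) + 1), by positivity, hn', ENNReal.toReal_le_of_le_ofReal hε.le hn⟩

/-- In a bounded open set, a small Lipschitz function vanishing on the boundary whose gradient is,
up to a set of small measure, either `(1 - l) ξ` or `-l ξ`. -/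
lemma exists_laminate {O : Set E3} (hO : IsOpen O) (hb : Bornology.IsBounded O) {ξ : E3}
    (hξ : ‖ξ‖ = 1) {l : ℝ} (hl : 0 < l) (hl' : l < 1) {ε : ℝ} (hε : 0 < ε) :
    ∃ (f : E3 → ℝ) (O₁ O₂ : Set E3), LipschitzWith 1 f ∧ HasCompactSupport f ∧
      (∀ x, |f x| ≤ ε) ∧ (∀ x ∉ O, f x = 0) ∧ (∀ x ∉ O, ∀ v, lineDeriv ℝ f x v = 0) ∧
      IsOpen O₁ ∧ IsOpen O₂ ∧ O₁ ⊆ O ∧ O₂ ⊆ O ∧ Disjoint O₁ O₂ ∧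
      volume.real (O \ (O₁ ∪ O₂)) ≤ ε ∧
      (∀ x ∈ O₁, ∀ v, lineDeriv ℝ f x v = (1 - l) * inner ℝ ξ v) ∧
      (∀ x ∈ O₂, ∀ v, lineDeriv ℝ f x v = -l * inner ℝ ξ v) := by
  obtain ⟨δ, hδ, hδε, hvol⟩ := exists_volume_infDist_le hO hb hε
  let p : E3 → ℝ := fun x => inner ℝ ξ x / δ
  have hp : Continuous p := by fun_prop
  -- The sawtooth has period and height of order `δ`, hence slopes independent of `δ`. Truncating by
  -- the distance to `Oᶜ` keeps the Lipschitz constant and changes nothing at distance more than `δ`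
  -- from `Oᶜ`.
  let f : E3 → ℝ := fun x => min (δ * sawtooth l (p x)) (Metric.infDist x Oᶜ)
  have hsaw : ∀ x, 0 ≤ δ * sawtooth l (p x) := fun x =>
    mul_nonneg hδ.le (sawtooth_nonneg hl.le hl'.le _)
  have hsaw' : ∀ x, δ * sawtooth l (p x) ≤ δ := fun x =>
    mul_le_of_le_one_right hδ.le (sawtooth_le_one hl.le _)
  have hf0 : ∀ x, 0 ≤ f x := fun x => le_min (hsaw x) Metric.infDist_nonneg
  have hfO : ∀ x ∉ O, f x = 0 := fun x hx => by
    have : Metric.infDist x Oᶜ = 0 := Metric.infDist_zero_of_mem hx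
    simp only [f, this]
    exact min_eq_right (hsaw x)
  have hlip : LipschitzWith 1 fun x => δ * sawtooth l (p x) := by
    refine LipschitzWith.of_le_add fun x y => ?_
    have h := (lipschitzWith_sawtooth hl.le hl'.le).dist_le_mul (p x) (p y)
    rw [Real.dist_eq, Real.dist_eq] at h
    have h2 : |p x - p y| ≤ dist x y / δ := by
      have : p x - p y = inner ℝ ξ (x - y) / δ := by simp only [p, inner_sub_right]; ring
      rw [this, abs_div, abs_of_pos hδ, dist_eq_norm]
      gcongr
      simpa [hξ] using abs_real_inner_le_norm ξ (x - y)
    have h3 : sawtooth l (p x) - sawtooth l (p y) ≤ dist x y / δ := by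
      have := le_abs_self (sawtooth l (p x) - sawtooth l (p y))
      simp only [NNReal.coe_one, one_mul] at h
      linarith
    have h4 := mul_le_mul_of_nonneg_left h3 hδ.le
    rw [mul_div_cancel₀ _ hδ.ne'] at h4
    linarith
  let W : Set E3 := {x | δ < Metric.infDist x Oᶜ}
  have hW : IsOpen W := isOpen_lt continuous_const (Metric.continuous_infDist_pt _)
  have hWO : W ⊆ O := fun x hx => by
    by_contra h
    have : Metric.infDist x Oᶜ = 0 := Metric.infDist_zero_of_mem h
    have hx' : δ < Metric.infDist x Oᶜ := hx
    linarith
  have hfW : ∀ x ∈ W, f x = δ * sawtooth l (p x) := fun x hx =>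
    min_eq_left ((hsaw' x).trans (le_of_lt hx))
  let S₁ : ℤ → Set E3 := fun k => {x | (k : ℝ) < p x ∧ p x < k + l}
  let S₂ : ℤ → Set E3 := fun k => {x | (k : ℝ) + l < p x ∧ p x < k + 1}
  have hS₁ : ∀ k, IsOpen (S₁ k) := fun k =>
    (isOpen_lt continuous_const hp).inter (isOpen_lt hp continuous_const)
  have hS₂ : ∀ k, IsOpen (S₂ k) := fun k =>
    (isOpen_lt continuous_const hp).inter (isOpen_lt hp continuous_const)
  have hpδ : ∀ y, δ * p y = inner ℝ ξ y := fun y => mul_div_cancel₀ _ hδ.ne'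
  refine ⟨f, W ∩ ⋃ k, S₁ k, W ∩ ⋃ k, S₂ k, ?_, ?_, ?_, hfO, ?_, hW.inter (isOpen_iUnion hS₁),
    hW.inter (isOpen_iUnion hS₂), inter_subset_left.trans hWO, inter_subset_left.trans hWO,
    ?_, ?_, ?_, ?_⟩
  · simpa using hlip.min (Metric.lipschitz_infDist_pt Oᶜ)
  · exact HasCompactSupport.intro hb.isCompact_closure fun x hx =>
      hfO x fun h => hx (subset_closure h)
  · intro x
    rw [abs_of_nonneg (hf0 x)]
    exact (min_le_left _ _).trans ((hsaw' x).trans hδε)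
  · intro x hx v
    exact lineDeriv_eq_zero_of_forall_le (fun y => (hfO x hx).trans_le (hf0 y)) v
  · rw [Set.disjoint_left]
    rintro x ⟨-, hx⟩ ⟨-, hx'⟩
    obtain ⟨k, hk⟩ := mem_iUnion.1 hx
    obtain ⟨m, hm⟩ := mem_iUnion.1 hx'
    have h1 : ⌊p x⌋ = k := Int.floor_eq_iff.2 ⟨hk.1.le, by linarith [hk.2]⟩
    have h2 : ⌊p x⌋ = m := Int.floor_eq_iff.2 ⟨by linarith [hm.1], hm.2⟩
    have h3 : k = m := h1.symm.trans h2
    subst h3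
    linarith [hk.2, hm.1]
  · have hsub : O \ (W ∩ (⋃ k, S₁ k) ∪ W ∩ ⋃ k, S₂ k) ⊆ {x ∈ O | Metric.infDist x Oᶜ ≤ δ} ∪
        ⋃ k : ℤ, ({x | inner ℝ ξ x = δ * k} ∪ {x | inner ℝ ξ x = δ * (k + l)}) := by
      rintro x ⟨hxO, hx⟩
      by_cases hxW : x ∈ W
      · right
        have h1 := Int.floor_le (p x)
        have h2 := Int.lt_floor_add_one (p x)
        refine mem_iUnion.2 ⟨⌊p x⌋, ?_⟩
        simp only [mem_union, mem_ofPred_eq, ← hpδ, mul_right_inj' hδ.ne']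
        by_contra! hcon
        refine hx ?_
        have h1' := lt_of_le_of_ne h1 hcon.1.symm
        rcases lt_or_gt_of_ne hcon.2 with h | h
        · exact Or.inl ⟨hxW, mem_iUnion.2 ⟨_, h1', h⟩⟩
        · exact Or.inr ⟨hxW, mem_iUnion.2 ⟨_, h, h2⟩⟩
      · exact Or.inl ⟨hxO, not_lt.1 hxW⟩
    have hnull : volume (⋃ k : ℤ, ({x : E3 | inner ℝ ξ x = δ * k} ∪
        {x | inner ℝ ξ x = δ * (k + l)})) = 0 := by
      have hξ0 : ξ ≠ 0 := by
        rintro rfl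
        simp at hξ
      exact measure_iUnion_null fun k =>
        measure_union_null (volume_inner_eq_const hξ0 _) (volume_inner_eq_const hξ0 _)
    have hfin : volume {x ∈ O | Metric.infDist x Oᶜ ≤ δ} ≠ ⊤ :=
      ((measure_mono (fun x hx => hx.1)).trans_lt hb.measure_lt_top).ne
    refine le_trans ?_ hvol
    refine ENNReal.toReal_mono hfin ((measure_mono hsub).trans ?_)
    exact (measure_union_le _ _).trans (by rw [hnull, add_zero])
  · rintro x ⟨hxW, hx⟩ v
    obtain ⟨k, hk⟩ := mem_iUnion.1 hx
    refine lineDeriv_eq_of_eventuallyEq_affine (b := -((1 - l) * (δ * k))) ?_ v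
    filter_upwards [hW.mem_nhds hxW, (hS₁ k).mem_nhds hk] with y hyW hy
    rw [hfW y hyW, sawtooth_eq_of_mem_Ioo_left hl'.le hy.1 hy.2, ← hpδ]
    ring
  · rintro x ⟨hxW, hx⟩ v
    obtain ⟨k, hk⟩ := mem_iUnion.1 hx
    refine lineDeriv_eq_of_eventuallyEq_affine (b := l * (δ * k) + l * δ) ?_ v
    filter_upwards [hW.mem_nhds hxW, (hS₂ k).mem_nhds hk] with y hyW hy
    rw [hfW y hyW, sawtooth_eq_of_mem_Ioo_right hl.le hy.1 hy.2, ← hpδ]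
    ring

/-! ### Commuting derivatives and lamination directions. -/

/-- One integration by parts moves the derivative off the merely Lipschitz `f`; the symmetry of the
second derivative of `φ` does the rest. -/
lemma integral_lineDeriv_mul_fderiv_comm {f φ : E3 → ℝ} {K : NNReal} (hf : LipschitzWith K f)
    (hφ : ContDiff ℝ ∞ φ) (hφc : HasCompactSupport φ) (a b : E3) :
    ∫ x, lineDeriv ℝ f x a * fderiv ℝ φ x b = ∫ x, lineDeriv ℝ f x b * fderiv ℝ φ x a := by
  have hφ1 : ContDiff ℝ ∞ (fderiv ℝ φ) := hφ.fderiv_right (by simp)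
  have key : ∀ a b : E3, ∫ x, lineDeriv ℝ f x a * fderiv ℝ φ x b =
      ∫ x, -(fderiv ℝ (fderiv ℝ φ) x a b) * f x := by
    intro a b
    have hg : ContDiff ℝ ∞ fun x => fderiv ℝ φ x b := hφ1.clm_apply contDiff_const
    have hgc : HasCompactSupport fun x => fderiv ℝ φ x b :=
      (hφc.fderiv ℝ).comp_left (g := fun T : E3 →L[ℝ] ℝ => T b) rfl
    obtain ⟨C, hC⟩ := hg.lipschitzWith_of_hasCompactSupport hgc (by simp)
    rw [hf.integral_lineDeriv_mul_eq hC hgc]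
    congr 1
    ext x
    have hd : DifferentiableAt ℝ (fderiv ℝ φ) x := hφ1.differentiable (by simp) x
    have hd' : HasFDerivAt (fun x => fderiv ℝ φ x b)
        ((ContinuousLinearMap.apply ℝ ℝ b).comp (fderiv ℝ (fderiv ℝ φ) x)) x :=
      (ContinuousLinearMap.apply ℝ ℝ b).hasFDerivAt.comp x hd.hasFDerivAt
    rw [(hd'.hasLineDerivAt (-a)).lineDeriv]
    simp
  rw [key a b, key b a]
  congr 1
  ext x
  have hs : IsSymmSndFDerivAt ℝ φ x := hφ.contDiffAt.isSymmSndFDerivAt (by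
    simp only [minSmoothness_of_isRCLikeNormedField]
    exact WithTop.coe_le_coe.2 le_top)
  rw [hs.eq a b]

/-- Two vectors cannot span `ℝ³`. This is why every direction of `ℝ¹⁰` is available for lamination.
-/
lemma exists_norm_eq_one_inner_eq_zero (a b : E3) :
    ∃ ξ : E3, ‖ξ‖ = 1 ∧ inner ℝ ξ a = 0 ∧ inner ℝ ξ b = 0 := by
  have hlt : Submodule.span ℝ ({a, b} : Set E3) < ⊤ := by
    refine lt_top_iff_ne_top.2 fun h => ?_
    have h1 : Module.finrank ℝ (Submodule.span ℝ ({a, b} : Set E3)) ≤ 2 := by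
      have := finrank_span_finset_le_card (R := ℝ) ({a, b} : Finset E3)
      rw [Finset.coe_pair] at this
      exact this.trans Finset.card_le_two
    rw [h, finrank_top, finrank_euclideanSpace_fin] at h1
    omega
  have hne : (Submodule.span ℝ ({a, b} : Set E3))ᗮ ≠ ⊥ := fun h =>
    hlt.ne ((Submodule.orthogonal_eq_bot_iff).1 h)
  obtain ⟨η, hη, hη0⟩ := Submodule.exists_mem_ne_zero_of_ne_bot hne
  have hη' := (Submodule.mem_orthogonal' _ _).1 hη
  refine ⟨‖η‖⁻¹ • η, ?_, ?_, ?_⟩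
  · rw [norm_smul, norm_inv, norm_norm, inv_mul_cancel₀ (norm_ne_zero_iff.2 hη0)]
  · rw [real_inner_smul_left, hη' a (Submodule.subset_span (by simp)), mul_zero]
  · rw [real_inner_smul_left, hη' b (Submodule.subset_span (by simp)), mul_zero]

/-! ### The manifold as a graph over `(D, B)`. -/

/-- The point of the Born-Infeld manifold with given components `D` and `B`. -/
noncomputable def toBornInfeld (w : E3 × E3) : State :=
  (w.1, w.2, wedge w.1 w.2, Real.sqrt (1 + ‖w.1‖ ^ 2 + ‖w.2‖ ^ 2 + ‖wedge w.1 w.2‖ ^ 2))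

lemma toBornInfeld_mem (w : E3 × E3) : toBornInfeld w ∈ bornInfeld := ⟨rfl, rfl⟩

lemma toBornInfeld_eq_of_mem {v : State} (hv : v ∈ bornInfeld) :
    toBornInfeld (v.D, v.B) = v := by
  obtain ⟨D, B, P, h⟩ := v
  obtain ⟨h1, h2⟩ := hv
  simp only [State.D, State.B, State.P, State.h] at h1 h2 ⊢
  subst h1
  rw [h2]
  rfl

lemma continuous_wedge : Continuous fun w : E3 × E3 => wedge w.1 w.2 := by
  unfold wedge
  refine (PiLp.continuous_toLp 2 _).comp (continuous_pi fun i => ?_)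
  fin_cases i <;> simp [crossProduct] <;> fun_prop

lemma continuous_toBornInfeld : Continuous toBornInfeld := by
  have := continuous_wedge
  unfold toBornInfeld
  fun_prop

namespace State

lemma continuous_D : Continuous D := continuous_fst

lemma continuous_B : Continuous B := continuous_fst.comp continuous_snd

lemma norm_D_le (v : State) : ‖v.D‖ ≤ ‖v‖ := norm_fst_le v

lemma norm_B_le (v : State) : ‖v.B‖ ≤ ‖v‖ := (norm_fst_le v.2).trans (norm_snd_le v)

end State

/-! ### Divergence-free extensions. -/

lemma integrable_fderiv_apply {φ : E3 → ℝ} (hφ : ContDiff ℝ ∞ φ) (hφc : HasCompactSupport φ)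
    {μ : Measure E3} [IsFiniteMeasureOnCompacts μ] {u : E3 → E3} (hu : AEStronglyMeasurable u μ)
    {C : ℝ} (hC : ∀ᵐ x ∂μ, ‖u x‖ ≤ C) : Integrable (fun x => fderiv ℝ φ x (u x)) μ := by
  have hc : Continuous (fderiv ℝ φ) := hφ.continuous_fderiv (by simp)
  have hi : Integrable (fderiv ℝ φ) μ := hc.integrable_of_hasCompactSupport (hφc.fderiv ℝ)
  refine Integrable.mono' (hi.norm.mul_const C) ?_ ?_
  · exact isBoundedBilinearMap_apply.continuous.comp_aestronglyMeasurable₂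
      hc.aestronglyMeasurable hu
  · filter_upwards [hC] with x hx
    exact ((fderiv ℝ φ x).le_opNorm _).trans (mul_le_mul_of_nonneg_left hx (norm_nonneg _))

lemma integral_add_add {E : Type*} [NormedAddCommGroup E] [NormedSpace ℝ E] {μ : Measure E3}
    {f g h : E3 → E} (hf : Integrable f μ) (hg : Integrable g μ) (hh : Integrable h μ) :
    ∫ x, (f x + g x + h x) ∂μ = ∫ x, f x ∂μ + ∫ x, g x ∂μ + ∫ x, h x ∂μ := by
  rw [integral_add (f := fun x => f x + g x) (hf.add hg) hh, integral_add hf hg]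

/-- The extension of `u - a` by zero outside of `O` is divergence free on the whole space. -/
def DivFreeExtension (O : Set E3) (a : E3) (u : E3 → E3) : Prop :=
  ∀ φ : E3 → ℝ, ContDiff ℝ ∞ φ → HasCompactSupport φ → ∫ x in O, fderiv ℝ φ x (u x - a) = 0

/-- Formally the divergence is `∂_b ∂_ξ f - ∂_ξ ∂_b f = 0`. -/
lemma divFreeExtension_laminate {O : Set E3} {f : E3 → ℝ} (hf : LipschitzWith 1 f)
    (hfO : ∀ x ∉ O, ∀ v, lineDeriv ℝ f x v = 0) (a b ξ : E3) :
    DivFreeExtension O a fun x => a + lineDeriv ℝ f x ξ • b - lineDeriv ℝ f x b • ξ := by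
  intro φ hφ hφc
  rw [setIntegral_eq_integral_of_forall_compl_eq_zero]
  · have h1 : ∀ v w : E3, Integrable fun x => lineDeriv ℝ f x v * fderiv ℝ φ x w := by
      intro v w
      have hm := (stronglyMeasurable_lineDeriv (𝕜 := ℝ) (v := v) hf.continuous)
      have := integrable_fderiv_apply hφ hφc (μ := volume) (u := fun x => lineDeriv ℝ f x v • w)
        (hm.smul_const w).aestronglyMeasurable (C := ‖v‖ * ‖w‖) (Eventually.of_forall fun x => by
          rw [norm_smul]
          gcongr
          simpa using norm_lineDeriv_le_of_lipschitz ℝ hf (v := v) (x₀ := x))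
      simpa using this
    have h2 := integral_lineDeriv_mul_fderiv_comm hf hφ hφc ξ b
    rw [← sub_eq_zero, ← integral_sub (h1 _ _) (h1 _ _)] at h2
    rw [← h2]
    congr 1
    ext x
    simp [add_sub_assoc]
  · intro x hx
    simp [hfO x hx]

/-- On `O`, `v - a` is `u - a` plus the extensions by zero of `u₁ - a₁` and `u₂ - a₂`, because `u`
equals `aᵢ` on `Oᵢ`. Each summand is divergence free on the whole space, so no interface terms
arise. -/
lemma DivFreeExtension.glue {O O₁ O₂ : Set E3} (hO₁ : MeasurableSet O₁) (hO₂ : MeasurableSet O₂)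
    (h₁ : O₁ ⊆ O) (h₂ : O₂ ⊆ O) (hd : Disjoint O₁ O₂) {a a₁ a₂ : E3} {u u₁ u₂ v : E3 → E3}
    (hu : DivFreeExtension O a u) (hu₁ : DivFreeExtension O₁ a₁ u₁)
    (hu₂ : DivFreeExtension O₂ a₂ u₂) (hum : Measurable u) (hum₁ : Measurable u₁)
    (hum₂ : Measurable u₂) {C : ℝ} (huC : ∀ x, ‖u x‖ ≤ C) (huC₁ : ∀ x, ‖u₁ x‖ ≤ C)
    (huC₂ : ∀ x, ‖u₂ x‖ ≤ C) (hua₁ : ∀ x ∈ O₁, u x = a₁) (hua₂ : ∀ x ∈ O₂, u x = a₂)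
    (hv₁ : ∀ x ∈ O₁, v x = u₁ x) (hv₂ : ∀ x ∈ O₂, v x = u₂ x)
    (hv : ∀ x ∉ O₁ ∪ O₂, v x = u x) : DivFreeExtension O a v := by
  intro φ hφ hφc
  have hint : ∀ (w : E3 → E3) (b : E3), Measurable w → (∀ x, ‖w x‖ ≤ C) →
      IntegrableOn (fun x => fderiv ℝ φ x (w x - b)) O := fun w b hw hwC =>
    integrable_fderiv_apply hφ hφc (hw.sub_const b).aestronglyMeasurable (C := C + ‖b‖)
      (Eventually.of_forall fun x => (norm_sub_le _ _).trans (by gcongr; exact hwC x))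
  have heq : (fun x => fderiv ℝ φ x (v x - a)) = fun x => fderiv ℝ φ x (u x - a) +
      O₁.indicator (fun x => fderiv ℝ φ x (u₁ x - a₁)) x +
      O₂.indicator (fun x => fderiv ℝ φ x (u₂ x - a₂)) x := by
    ext x
    by_cases hx₁ : x ∈ O₁
    · have hx₂ : x ∉ O₂ := Set.disjoint_left.1 hd hx₁
      simp [hx₁, hx₂, hv₁, hua₁]
    · by_cases hx₂ : x ∈ O₂
      · simp [hx₁, hx₂, hv₂, hua₂]
      · simp [hx₁, hx₂, hv x (by simp [hx₁, hx₂])]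
  have hi₁ := (hint u₁ a₁ hum₁ huC₁).indicator hO₁
  have hi₂ := (hint u₂ a₂ hum₂ huC₂).indicator hO₂
  rw [heq, integral_add_add (hint u a hum huC) hi₁ hi₂,
    setIntegral_indicator hO₁, setIntegral_indicator hO₂, inter_eq_self_of_subset_right h₁,
    inter_eq_self_of_subset_right h₂, hu φ hφ hφc, hu₁ φ hφ hφc, hu₂ φ hφ hφc]
  simp

/-! ### Convexity of the set of approximable states. -/

/-- `V` takes values in the Born-Infeld manifold and is weakly close to the constant `c` on `O`. Its
components `D` and `B` extended by those of `c` outside of `O` are divergence free. -/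
structure IsApprox (C ε : ℝ) (c : State) (O : Set E3) (V : E3 → State) : Prop where
  measurable : Measurable V
  norm_le : ∀ x, ‖V x‖ ≤ C
  mem_bornInfeld : ∀ x, V x ∈ bornInfeld
  divFree_D : DivFreeExtension O c.D fun x => (V x).D
  divFree_B : DivFreeExtension O c.B fun x => (V x).B
  norm_integral_le : ∀ φ : E3 → ℝ, LipschitzWith 1 φ → (∀ x, |φ x| ≤ 1) →
    ‖∫ x in O, φ x • (V x - c)‖ ≤ ε

lemma isApprox_const {C ε : ℝ} (hε : 0 ≤ ε) {c : State} (hc : c ∈ bornInfeld) (hC : ‖c‖ ≤ C)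
    (O : Set E3) : IsApprox C ε c O fun _ => c where
  measurable := measurable_const
  norm_le _ := hC
  mem_bornInfeld _ := hc
  divFree_D := fun φ _ _ => by simp
  divFree_B := fun φ _ _ => by simp
  norm_integral_le := fun φ _ _ => by simpa using hε

/-- For empty pieces of `F`, whose constant is arbitrary and need not be approximable. -/
lemma isApprox_empty {C ε : ℝ} (hε : 0 ≤ ε) {v : State} (hv : v ∈ bornInfeld) (hC : ‖v‖ ≤ C)
    (c : State) : IsApprox C ε c ∅ fun _ => v where
  measurable := measurable_const
  norm_le _ := hC
  mem_bornInfeld _ := hv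
  divFree_D := fun φ _ _ => by simp
  divFree_B := fun φ _ _ => by simp
  norm_integral_le := fun φ _ _ => by simpa using hε

/-- The derivative of `f` is not small, but integration by parts puts it on `φ` and leaves the small
factor `f`. -/
lemma abs_setIntegral_mul_lineDeriv_le {O : Set E3} (hb : Bornology.IsBounded O) {f φ : E3 → ℝ}
    (hf : LipschitzWith 1 f) (hfc : HasCompactSupport f) {ε : ℝ} (hε : ∀ x, |f x| ≤ ε)
    (hfO : ∀ x ∉ O, f x = 0) {ξ : E3} (hξ : ‖ξ‖ = 1)
    (hfO' : ∀ x ∉ O, ∀ v, lineDeriv ℝ f x v = 0) (hφ : LipschitzWith 1 φ) :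
    |∫ x in O, φ x * lineDeriv ℝ f x ξ| ≤ ε * volume.real O := by
  have h := LipschitzWith.integral_lineDeriv_mul_eq (μ := volume) hφ hf hfc (-ξ)
  rw [neg_neg] at h
  rw [setIntegral_eq_integral_of_forall_compl_eq_zero (fun x hx => by simp [hfO' x hx])]
  simp_rw [mul_comm (φ _)]
  rw [← h, ← setIntegral_eq_integral_of_forall_compl_eq_zero (s := O)
    (fun x hx => by simp [hfO x hx])]
  rw [← Real.norm_eq_abs]
  refine norm_setIntegral_le_of_norm_le_const hb.measure_lt_top fun x _ => ?_
  have h1 := norm_lineDeriv_le_of_lipschitz ℝ hφ (v := -ξ) (x₀ := x)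
  rw [norm_neg, hξ] at h1
  rw [norm_mul]
  calc _ ≤ 1 * ε := mul_le_mul (by simpa using h1) (hε x) (abs_nonneg _) zero_le_one
    _ = ε := one_mul ε

/-- States that are weak limits, on any bounded open set, of divergence free fields with values in a
fixed bounded part of the Born-Infeld manifold. -/
def approximable (r C : ℝ) : Set State :=
  {c | ‖c.D‖ ≤ r ∧ ‖c.B‖ ≤ r ∧ ∀ O : Set E3, IsOpen O → Bornology.IsBounded O →
    ∀ ε > 0, ∃ V, IsApprox C ε c O V}

lemma norm_laminate_le {r t s : ℝ} {a b ξ : E3} (ha : ‖a‖ ≤ r) (hb : ‖b‖ ≤ 2 * r) (hξ : ‖ξ‖ = 1)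
    (ht : |t| ≤ 1) (hs : |s| ≤ ‖b‖) : ‖a + t • b - s • ξ‖ ≤ 5 * r := by
  have h1 : ‖t • b‖ ≤ 2 * r := by
    rw [norm_smul, Real.norm_eq_abs]
    nlinarith [norm_nonneg b]
  have h2 : ‖s • ξ‖ ≤ 2 * r := by
    rw [norm_smul, hξ, mul_one, Real.norm_eq_abs]
    linarith
  linarith [norm_sub_le (a + t • b) (s • ξ), norm_add_le a (t • b)]

lemma norm_convexCombo_le {r l : ℝ} (hl : 0 < l) (hl' : l < 1) {a b : E3} (ha : ‖a‖ ≤ r)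
    (hb : ‖b‖ ≤ r) : ‖l • a + (1 - l) • b‖ ≤ r := by
  have := (convex_closedBall (0 : E3) r) (mem_closedBall_zero_iff.2 ha)
    (mem_closedBall_zero_iff.2 hb) hl.le (sub_nonneg.2 hl'.le) (by ring)
  exact mem_closedBall_zero_iff.1 this

/-- Laminate `c₁` and `c₂`, then insert their approximations on `O₁` and `O₂`, which is possible
since approximability is required on every bounded open set. The bound `C` survives because the
residual field is controlled by `r` alone, and `r` bounds `D` and `B` of any convex combination. -/
lemma convexCombo_mem_approximable {r C : ℝ}
    (hC : ∀ w : E3 × E3, ‖w‖ ≤ 5 * r → ‖toBornInfeld w‖ ≤ C) {c₁ c₂ : State}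
    (hc₁ : c₁ ∈ approximable r C) (hc₂ : c₂ ∈ approximable r C) {l : ℝ} (hl : 0 < l)
    (hl' : l < 1) : l • c₁ + (1 - l) • c₂ ∈ approximable r C := by
  obtain ⟨hD₁, hB₁, happ₁⟩ := hc₁
  obtain ⟨hD₂, hB₂, happ₂⟩ := hc₂
  set c := l • c₁ + (1 - l) • c₂ with hc
  set d := c₁ - c₂ with hd
  have hcD : ‖c.D‖ ≤ r := norm_convexCombo_le hl hl' hD₁ hD₂
  have hcB : ‖c.B‖ ≤ r := norm_convexCombo_le hl hl' hB₁ hB₂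
  have hdD : ‖d.D‖ ≤ 2 * r := (norm_sub_le c₁.D c₂.D).trans (by linarith)
  have hdB : ‖d.B‖ ≤ 2 * r := (norm_sub_le c₁.B c₂.B).trans (by linarith)
  have hr : 0 ≤ r := (norm_nonneg _).trans hcD
  have hc₁ : c + (1 - l) • d = c₁ := by rw [hc, hd]; module
  have hc₂ : c + (-l) • d = c₂ := by rw [hc, hd]; module
  have hC0 : 0 ≤ C := (norm_nonneg _).trans (hC 0 (by rw [norm_zero]; positivity))
  refine ⟨hcD, hcB, fun O hO hb ε hε => ?_⟩
  obtain ⟨ξ, hξ, hξD, hξB⟩ := exists_norm_eq_one_inner_eq_zero d.D d.B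
  -- `K` collects the factors of the laminate tolerance in the oscillation error and in the residual
  -- error. These two share `ε / 3`, and `V₁`, `V₂` cost `ε / 3` each.
  set K := volume.real O * ‖d‖ + (C + ‖c‖ + ‖d‖) with hK
  have hK0 : 0 ≤ K := by positivity
  obtain ⟨f, O₁, O₂, hf, hfc, hfε, hfO, hfO', hO₁, hO₂, hOO₁, hOO₂, hdisj, hvol, hf₁, hf₂⟩ :=
    exists_laminate hO hb hξ hl hl' (ε := ε / 3 / (K + 1)) (by positivity)
  obtain ⟨V₁, hV₁⟩ := happ₁ O₁ hO₁ (hb.subset hOO₁) (ε / 3) (by positivity)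
  obtain ⟨V₂, hV₂⟩ := happ₂ O₂ hO₂ (hb.subset hOO₂) (ε / 3) (by positivity)
  have hm : ∀ v, Measurable fun x => lineDeriv ℝ f x v := fun v =>
    measurable_lineDeriv (𝕜 := ℝ) (v := v) hf.continuous
  have hθ : ∀ x v, |lineDeriv ℝ f x v| ≤ ‖v‖ := fun x v => by
    simpa using norm_lineDeriv_le_of_lipschitz ℝ hf (v := v) (x₀ := x)
  let u : E3 → E3 → E3 → E3 := fun a b x =>
    a + lineDeriv ℝ f x ξ • b - lineDeriv ℝ f x b • ξ
  have hu : ∀ a b, Measurable (u a b) := fun a b =>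
    (((hm ξ).smul_const b).const_add a).sub ((hm b).smul_const ξ)
  -- For `b ⟂ ξ` the correction `(∂_b f) ξ` vanishes where the gradient is parallel to `ξ`.
  have hu₁ : ∀ a b, inner ℝ ξ b = 0 → ∀ x ∈ O₁, u a b x = a + (1 - l) • b := by
    intro a b hab x hx
    simp [u, hf₁ x hx, hab, hξ]
  have hu₂ : ∀ a b, inner ℝ ξ b = 0 → ∀ x ∈ O₂, u a b x = a + (-l) • b := by
    intro a b hab x hx
    simp [u, hf₂ x hx, hab, hξ]
  have hθ1 : ∀ x, |lineDeriv ℝ f x ξ| ≤ 1 := fun x => hξ ▸ hθ x ξ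
  have huD : ∀ x, ‖u c.D d.D x‖ ≤ 5 * r := fun x =>
    norm_laminate_le hcD hdD hξ (hθ1 x) (hθ x _)
  have huB : ∀ x, ‖u c.B d.B x‖ ≤ 5 * r := fun x =>
    norm_laminate_le hcB hdB hξ (hθ1 x) (hθ x _)
  classical
  let U : E3 → State := fun x => toBornInfeld (u c.D d.D x, u c.B d.B x)
  have hU : Measurable U :=
    continuous_toBornInfeld.measurable.comp ((hu c.D d.D).prodMk (hu c.B d.B))
  have hUC : ∀ x, ‖U x‖ ≤ C := fun x => hC _ (max_le (huD x) (huB x))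
  let V : E3 → State := O₁.piecewise V₁ (O₂.piecewise V₂ U)
  have hVm : Measurable V :=
    hV₁.measurable.piecewise hO₁.measurableSet (hV₂.measurable.piecewise hO₂.measurableSet hU)
  have hV1 : ∀ x ∈ O₁, V x = V₁ x := fun x hx => piecewise_eq_of_mem _ _ _ hx
  have hV2 : ∀ x ∈ O₂, V x = V₂ x := fun x hx => by
    simp [V, hx, Set.disjoint_right.1 hdisj hx]
  have hV3 : ∀ x ∉ O₁ ∪ O₂, V x = U x := fun x hx => by
    rw [mem_union, not_or] at hx
    simp [V, hx.1, hx.2]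
  have hVC : ∀ x, ‖V x‖ ≤ C := fun x => by
    by_cases hx₁ : x ∈ O₁
    · rw [hV1 x hx₁]; exact hV₁.norm_le x
    by_cases hx₂ : x ∈ O₂
    · rw [hV2 x hx₂]; exact hV₂.norm_le x
    · rw [hV3 x (by simp [hx₁, hx₂])]; exact hUC x
  refine ⟨V, hVm, hVC, fun x => ?_, ?_, ?_, fun φ hφ hφ1 => ?_⟩
  · by_cases hx₁ : x ∈ O₁
    · rw [hV1 x hx₁]; exact hV₁.mem_bornInfeld x
    by_cases hx₂ : x ∈ O₂
    · rw [hV2 x hx₂]; exact hV₂.mem_bornInfeld x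
    · rw [hV3 x (by simp [hx₁, hx₂])]; exact toBornInfeld_mem _
  · refine DivFreeExtension.glue hO₁.measurableSet hO₂.measurableSet hOO₁ hOO₂ hdisj
      (divFreeExtension_laminate hf hfO' c.D d.D ξ) hV₁.divFree_D hV₂.divFree_D (hu c.D d.D)
      (State.continuous_D.measurable.comp hV₁.measurable)
      (State.continuous_D.measurable.comp hV₂.measurable) (C := max (5 * r) C)
      (fun x => (huD x).trans (le_max_left _ _))
      (fun x => ((State.norm_D_le _).trans (hV₁.norm_le x)).trans (le_max_right _ _))
      (fun x => ((State.norm_D_le _).trans (hV₂.norm_le x)).trans (le_max_right _ _))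
      (fun x hx => (hu₁ _ _ hξD x hx).trans (congrArg State.D hc₁))
      (fun x hx => (hu₂ _ _ hξD x hx).trans (congrArg State.D hc₂))
      (fun x hx => congrArg State.D (hV1 x hx)) (fun x hx => congrArg State.D (hV2 x hx))
      (fun x hx => congrArg State.D (hV3 x hx))
  · refine DivFreeExtension.glue hO₁.measurableSet hO₂.measurableSet hOO₁ hOO₂ hdisj
      (divFreeExtension_laminate hf hfO' c.B d.B ξ) hV₁.divFree_B hV₂.divFree_B (hu c.B d.B)
      (State.continuous_B.measurable.comp hV₁.measurable)
      (State.continuous_B.measurable.comp hV₂.measurable) (C := max (5 * r) C)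
      (fun x => (huB x).trans (le_max_left _ _))
      (fun x => ((State.norm_B_le _).trans (hV₁.norm_le x)).trans (le_max_right _ _))
      (fun x => ((State.norm_B_le _).trans (hV₂.norm_le x)).trans (le_max_right _ _))
      (fun x hx => (hu₁ _ _ hξB x hx).trans (congrArg State.B hc₁))
      (fun x hx => (hu₂ _ _ hξB x hx).trans (congrArg State.B hc₂))
      (fun x hx => congrArg State.B (hV1 x hx)) (fun x hx => congrArg State.B (hV2 x hx))
      (fun x hx => congrArg State.B (hV3 x hx))
  · set N := O \ (O₁ ∪ O₂) with hN
    have hNm : MeasurableSet N :=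
      hO.measurableSet.diff (hO₁.measurableSet.union hO₂.measurableSet)
    have hOfin : volume O < ⊤ := hb.measure_lt_top
    have : IsFiniteMeasure (volume.restrict O) := isFiniteMeasure_restrict.2 hOfin.ne
    have hφm : Measurable φ := hφ.continuous.measurable
    have hbdd : ∀ (W : E3 → State) (M : ℝ), Measurable W → (∀ x, ‖W x‖ ≤ M) →
        IntegrableOn (fun x => φ x • W x) O := fun W M hW hM =>
      Integrable.of_bound (hφm.smul hW).aestronglyMeasurable M (Eventually.of_forall fun x => by
        rw [norm_smul]
        exact (mul_le_of_le_one_left (norm_nonneg _) (hφ1 x)).trans (hM x))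
    let R : E3 → State := fun x => V x - c - lineDeriv ℝ f x ξ • d
    have hRm : Measurable R := (hVm.sub_const c).sub ((hm ξ).smul_const d)
    have hθd : ∀ x, ‖lineDeriv ℝ f x ξ • d‖ ≤ ‖d‖ := fun x => by
      rw [norm_smul]
      exact mul_le_of_le_one_left (norm_nonneg _) (hθ1 x)
    have hRC : ∀ x, ‖R x‖ ≤ C + ‖c‖ + ‖d‖ := fun x => by
      have h1 := norm_sub_le (V x - c) (lineDeriv ℝ f x ξ • d)
      have h2 := norm_sub_le (V x) c
      linarith [hVC x, hθd x]
    have hsub : ∀ {W : E3 → State} (b : State), Measurable W → (∀ x, ‖W x‖ ≤ C) →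
        IntegrableOn (fun x => φ x • (W x - b)) O := fun b hW hWC =>
      hbdd _ (C + ‖b‖) (hW.sub_const b) fun x => (norm_sub_le _ _).trans (by gcongr; exact hWC x)
    have hi0 := hbdd _ _ ((hm ξ).smul_const d) hθd
    have hi1 := (hsub c₁ hV₁.measurable hV₁.norm_le).indicator hO₁.measurableSet
    have hi2 := (hsub c₂ hV₂.measurable hV₂.norm_le).indicator hO₂.measurableSet
    have hi3 := (hbdd R _ hRm hRC).indicator hNm
    -- After subtracting `(∂_ξ f) d`, what is left of `V - c` is `Vᵢ - cᵢ` on `Oᵢ` and the bounded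
    -- `R` on the small set `N`.
    have heq : ∫ x in O, φ x • (V x - c) = ∫ x in O, (φ x • (lineDeriv ℝ f x ξ • d) +
        O₁.indicator (fun x => φ x • (V₁ x - c₁)) x +
        O₂.indicator (fun x => φ x • (V₂ x - c₂)) x + N.indicator (fun x => φ x • R x) x) := by
      refine setIntegral_congr_fun hO.measurableSet fun x hx => ?_
      by_cases hx₁ : x ∈ O₁
      · have hx₂ : x ∉ O₂ := Set.disjoint_left.1 hdisj hx₁
        have hξ1 : lineDeriv ℝ f x ξ = 1 - l := by simp [hf₁ x hx₁, hξ]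
        simp only [hx₁, hx₂, hN, Set.mem_sdiff, mem_union, true_or, not_true, and_false,
          not_false_eq_true, indicator_of_mem, indicator_of_notMem, add_zero, hV1 x hx₁, hξ1,
          ← hc₁]
        module
      · by_cases hx₂ : x ∈ O₂
        · have hξ2 : lineDeriv ℝ f x ξ = -l := by simp [hf₂ x hx₂, hξ]
          simp only [hx₁, hx₂, hN, Set.mem_sdiff, mem_union, or_true, not_true, and_false,
            not_false_eq_true, indicator_of_mem, indicator_of_notMem, add_zero, hV2 x hx₂, hξ2,
            ← hc₂]
          module
        · simp only [hx₁, hx₂, hx, hN, Set.mem_sdiff, mem_union, or_self, and_true,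
            not_false_eq_true, indicator_of_mem, indicator_of_notMem, add_zero, R]
          module
    rw [heq, integral_add_add (f := fun x => φ x • (lineDeriv ℝ f x ξ • d) +
      O₁.indicator (fun x => φ x • (V₁ x - c₁)) x) (hi0.add hi1) hi2 hi3, integral_add hi0 hi1, setIntegral_indicator hO₁.measurableSet,
      setIntegral_indicator hO₂.measurableSet, setIntegral_indicator hNm,
      inter_eq_self_of_subset_right hOO₁, inter_eq_self_of_subset_right hOO₂,
      inter_eq_self_of_subset_right sdiff_subset]
    have e0 : ‖∫ x in O, φ x • (lineDeriv ℝ f x ξ • d)‖ ≤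
        ε / 3 / (K + 1) * volume.real O * ‖d‖ := by
      simp_rw [smul_smul]
      rw [integral_smul_const, norm_smul]
      gcongr
      exact abs_setIntegral_mul_lineDeriv_le hb hf hfc hfε hfO hξ hfO' hφ
    have e1 := hV₁.norm_integral_le φ hφ hφ1
    have e2 := hV₂.norm_integral_le φ hφ hφ1
    have e3 : ‖∫ x in N, φ x • R x‖ ≤ (C + ‖c‖ + ‖d‖) * (ε / 3 / (K + 1)) := by
      refine (norm_setIntegral_le_of_norm_le_const (C := C + ‖c‖ + ‖d‖)
        ((measure_mono sdiff_subset).trans_lt hOfin) fun x _ => ?_).trans (by gcongr)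
      rw [norm_smul]
      exact (mul_le_of_le_one_left (norm_nonneg _) (hφ1 x)).trans (hRC x)
    have e4 : ε / 3 / (K + 1) * volume.real O * ‖d‖ + (C + ‖c‖ + ‖d‖) * (ε / 3 / (K + 1)) ≤
        ε / 3 := by
      have : ε / 3 / (K + 1) * volume.real O * ‖d‖ + (C + ‖c‖ + ‖d‖) * (ε / 3 / (K + 1)) =
        ε / 3 / (K + 1) * K := by rw [hK]; ring
      rw [this, div_mul_eq_mul_div, div_le_iff₀ (by positivity)]
      nlinarith
    refine (norm_add₃_le.trans (add_le_add_left (add_le_add_left (norm_add_le _ _) _) _)).trans ?_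
    linarith

lemma convex_approximable {r C : ℝ}
    (hC : ∀ w : E3 × E3, ‖w‖ ≤ 5 * r → ‖toBornInfeld w‖ ≤ C) : Convex ℝ (approximable r C) := by
  rw [convex_iff_forall_pos]
  intro c₁ h₁ c₂ h₂ a b ha hb hab
  obtain rfl : b = 1 - a := by linarith
  exact convexCombo_mem_approximable hC h₁ h₂ ha (by linarith)

lemma convexHull_subset_approximable {r C : ℝ}
    (hC : ∀ w : E3 × E3, ‖w‖ ≤ 5 * r → ‖toBornInfeld w‖ ≤ C) :
    convexHull ℝ (toBornInfeld '' Metric.closedBall 0 r) ⊆ approximable r C := by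
  refine convexHull_min ?_ (convex_approximable hC)
  rintro _ ⟨w, hw, rfl⟩
  rw [mem_closedBall_zero_iff] at hw
  have hr : 0 ≤ r := (norm_nonneg w).trans hw
  exact ⟨(norm_fst_le w).trans hw, (norm_snd_le w).trans hw, fun O _ _ ε hε =>
    ⟨_, isApprox_const hε.le (toBornInfeld_mem w) (hC w (by linarith)) O⟩⟩

/-! ### Reduction to a bounded part of the manifold. -/

lemma exists_norm_toBornInfeld_le (r : ℝ) :
    ∃ C, ∀ w : E3 × E3, ‖w‖ ≤ r → ‖toBornInfeld w‖ ≤ C := by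
  obtain ⟨C, hC⟩ := (isCompact_closedBall (0 : E3 × E3) r).exists_bound_of_continuousOn
    continuous_toBornInfeld.continuousOn
  exact ⟨C, fun w hw => hC w (mem_closedBall_zero_iff.2 hw)⟩

/-- An interior point of the hull is interior to a simplex with vertices in the hull. These finitely
many vertices lie in the hull of one bounded part, so the interiors of such hulls cover `L`. -/
lemma exists_subset_convexHull_image_closedBall {L : Set State} (hL : IsCompact L)
    (hL_int : L ⊆ interior (convexHull ℝ bornInfeld)) :
    ∃ r : ℝ, L ⊆ convexHull ℝ (toBornInfeld '' Metric.closedBall 0 r) := by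
  let H : ℕ → Set State := fun n => convexHull ℝ (toBornInfeld '' Metric.closedBall 0 n)
  have hmono : Monotone H := fun m n hmn =>
    convexHull_mono (image_mono (Metric.closedBall_subset_closedBall (by exact_mod_cast hmn)))
  have hunion : convexHull ℝ bornInfeld ⊆ ⋃ n, H n := by
    refine convexHull_min (fun v hv => ?_)
      ((hmono.directed_le).convex_iUnion fun n => convex_convexHull ℝ _)
    obtain ⟨n, hn⟩ := exists_nat_ge ‖(v.D, v.B)‖
    exact mem_iUnion.2 ⟨n, subset_convexHull ℝ _
      ⟨_, mem_closedBall_zero_iff.2 hn, toBornInfeld_eq_of_mem hv⟩⟩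
  have hcover : L ⊆ ⋃ n, interior (H n) := by
    intro x hx
    obtain ⟨b, hb, hbs⟩ := exists_mem_interior_convexHull_affineBasis
      (mem_interior_iff_mem_nhds.1 (hL_int hx))
    have h1 : ∀ i, ∃ n, b i ∈ H n := fun i =>
      mem_iUnion.1 (hunion (hbs (subset_convexHull ℝ _ (mem_range_self i))))
    choose n hn using h1
    refine mem_iUnion.2 ⟨Finset.univ.sup n, interior_mono (convexHull_min ?_
      (convex_convexHull ℝ _)) hb⟩
    rintro _ ⟨i, rfl⟩
    exact hmono (Finset.le_sup (Finset.mem_univ i)) (hn i)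
  obtain ⟨n, hn⟩ := hL.elim_directed_cover (fun n => interior (H n)) (fun n => isOpen_interior)
    hcover (Monotone.directed_le fun m n hmn => interior_mono (hmono hmn))
  exact ⟨n, hn.trans interior_subset⟩

/-! ### Countable gluing and weak-star convergence. -/

/-- Fields that are close to the constant values of `F` on the members of a countable family of
disjoint open sets can be put together. -/
lemma exists_glue {Ω : Set E3} (hb : Bornology.IsBounded Ω) {F : E3 → State}
    (hFm : AEStronglyMeasurable F (volume.restrict Ω)) {C M : ℝ}
    (hFM : ∀ᵐ x ∂(volume.restrict Ω), ‖F x‖ ≤ M) {A : ℕ → Set E3} (hA : ∀ i, IsOpen (A i))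
    (hAΩ : ∀ i, A i ⊆ Ω) (hAd : Pairwise (Function.onFun Disjoint A))
    (hAc : volume (Ω \ ⋃ i, A i) = 0) {c : ℕ → State}
    (hc : ∀ i, ∀ᵐ x ∂(volume.restrict (A i)), F x = c i) {ε : ℝ}
    (happ : ∀ i, ∃ V, IsApprox C (ε / 2 / 2 ^ i) (c i) (A i) V)
    (hF_D : DivFreeOn (fun x => (F x).D) Ω) (hF_B : DivFreeOn (fun x => (F x).B) Ω) :
    ∃ V : E3 → State, Measurable V ∧ (∀ᵐ x ∂(volume.restrict Ω), ‖V x‖ ≤ C) ∧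
      (∀ᵐ x ∂(volume.restrict Ω), V x ∈ bornInfeld) ∧
      DivFreeOn (fun x => (V x).D) Ω ∧ DivFreeOn (fun x => (V x).B) Ω ∧
      ∀ φ : E3 → ℝ, LipschitzWith 1 φ → (∀ x, |φ x| ≤ 1) →
        ‖∫ x in Ω, φ x • (V x - F x)‖ ≤ ε := by
  choose W hW using happ
  have hAm : ∀ i, MeasurableSet (A i) := fun i => (hA i).measurableSet
  obtain ⟨V, hVm, hVW⟩ := exists_measurable_piecewise A hAm W (fun i => (hW i).measurable)
    (fun i j hij x hx => absurd hx.2 (Set.disjoint_left.1 (hAd hij) hx.1))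
  have hr : volume.restrict Ω = volume.restrict (⋃ i, A i) :=
    Measure.restrict_congr_set ((LE.le.eventuallyLE (iUnion_subset hAΩ)).antisymm
      (ae_le_set.2 hAc)).symm
  have hae : ∀ {p : E3 → Prop}, (∀ i, ∀ x ∈ A i, p x) → ∀ᵐ x ∂(volume.restrict Ω), p x := by
    intro p hp
    rw [hr]
    filter_upwards [ae_restrict_mem (MeasurableSet.iUnion hAm)] with x hx
    obtain ⟨i, hi⟩ := mem_iUnion.1 hx
    exact hp i x hi
  have hVC : ∀ᵐ x ∂(volume.restrict Ω), ‖V x‖ ≤ C := hae fun i x hx => by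
    rw [hVW i hx]; exact (hW i).norm_le x
  have : IsFiniteMeasure (volume.restrict Ω) := isFiniteMeasure_restrict.2 hb.measure_lt_top.ne
  have hVF : ∀ᵐ x ∂(volume.restrict Ω), ‖V x - F x‖ ≤ C + M := by
    filter_upwards [hVC, hFM] with x h1 h2
    exact (norm_sub_le _ _).trans (add_le_add h1 h2)
  have hVFm : AEStronglyMeasurable (fun x => V x - F x) (volume.restrict Ω) :=
    hVm.aestronglyMeasurable.sub hFm
  -- Used with `T` the pairing with `∇φ`, where every term vanishes, and with multiplication by `φ`,
  -- where the terms sum to at most `ε`.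
  have hpiece : ∀ {E : Type} [NormedAddCommGroup E] [NormedSpace ℝ E] (T : E3 → State → E),
      IntegrableOn (fun x => T x (V x - F x)) Ω →
      ∫ x in Ω, T x (V x - F x) = ∑' i, ∫ x in A i, T x (W i x - c i) := by
    intro E _ _ T hT
    rw [hr, integral_iUnion hAm hAd (by rwa [IntegrableOn, ← hr])]
    refine tsum_congr fun i => integral_congr_ae ?_
    filter_upwards [hc i, ae_restrict_mem (hAm i)] with x h1 h2
    rw [h1, hVW i h2]
  have hdiv : ∀ (p : State → E3), Continuous p → (∀ v, ‖p v‖ ≤ ‖v‖) →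
      (∀ v w, p (v - w) = p v - p w) →
      (∀ i, DivFreeExtension (A i) (p (c i)) fun x => p (W i x)) →
      DivFreeOn (fun x => p (F x)) Ω → DivFreeOn (fun x => p (V x)) Ω := by
    intro p hp hpn hps hpW hpF φ hφ hφc hφΩ
    have hiF : IntegrableOn (fun x => fderiv ℝ φ x (p (F x))) Ω :=
      integrable_fderiv_apply hφ hφc (hp.comp_aestronglyMeasurable hFm)
        (hFM.mono fun x hx => (hpn _).trans hx)
    have hiV : IntegrableOn (fun x => fderiv ℝ φ x (p (V x))) Ω :=
      integrable_fderiv_apply hφ hφc (hp.comp_aestronglyMeasurable hVm.aestronglyMeasurable)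
        (hVC.mono fun x hx => (hpn _).trans hx)
    have heq : ∀ x, fderiv ℝ φ x (p (V x - F x)) =
        fderiv ℝ φ x (p (V x)) - fderiv ℝ φ x (p (F x)) := fun x => by rw [hps, map_sub]
    have h1 := hpiece (fun x v => fderiv ℝ φ x (p v)) (by
      simp only [heq]
      exact hiV.sub hiF)
    simp only [heq] at h1
    rw [integral_sub hiV hiF, hpF φ hφ hφc hφΩ, sub_zero] at h1
    rw [h1]
    refine (tsum_congr fun i => ?_).trans tsum_zero
    simp only [hps]
    exact hpW i φ hφ hφc
  refine ⟨V, hVm, hVC, hae fun i x hx => ?_, ?_, ?_, fun φ hφ hφ1 => ?_⟩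
  · rw [hVW i hx]; exact (hW i).mem_bornInfeld x
  · exact hdiv State.D State.continuous_D State.norm_D_le (fun _ _ => rfl)
      (fun i => (hW i).divFree_D) hF_D
  · exact hdiv State.B State.continuous_B State.norm_B_le (fun _ _ => rfl)
      (fun i => (hW i).divFree_B) hF_B
  · rw [hpiece (fun x v => φ x • v)]
    · exact tsum_of_norm_bounded (hasSum_geometric_two' ε)
        fun i => (hW i).norm_integral_le φ hφ hφ1
    · refine Integrable.of_bound (hφ.continuous.aestronglyMeasurable.smul hVFm) (C + M) ?_
      filter_upwards [hVF] with x hx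
      rw [norm_smul]
      exact (mul_le_of_le_one_left (norm_nonneg _) (hφ1 x)).trans hx

/-- For bounded sequences, weak-star convergence can be tested with bounded Lipschitz functions. -/
lemma weakStarTendsto_of_lipschitz {Ω : Set E3} {V : ℕ → E3 → State} {F : E3 → State}
    (hV : ∀ j, AEStronglyMeasurable (V j) (volume.restrict Ω))
    (hF : AEStronglyMeasurable F (volume.restrict Ω)) {C M : ℝ}
    (hVC : ∀ j, ∀ᵐ x ∂(volume.restrict Ω), ‖V j x‖ ≤ C)
    (hFM : ∀ᵐ x ∂(volume.restrict Ω), ‖F x‖ ≤ M) {ε : ℕ → ℝ} (hε : Tendsto ε atTop (𝓝 0))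
    (h : ∀ j, ∀ φ : E3 → ℝ, LipschitzWith 1 φ → (∀ x, |φ x| ≤ 1) →
      ‖∫ x in Ω, φ x • (V j x - F x)‖ ≤ ε j) : WeakStarTendsto V F Ω := by
  intro φ hφ
  rw [Metric.tendsto_atTop']
  intro η hη
  set K := |C + M| + 1 with hK
  have hK0 : 0 < K := by positivity
  obtain ⟨g, hgc, hg, hφg⟩ := (memLp_one_iff_integrable.2 hφ).exist_eLpNorm_sub_le
    ENNReal.one_ne_top le_rfl (ε := η / 2 / K) (by positivity)
  obtain ⟨A, hA⟩ := hg.lipschitzWith_of_hasCompactSupport hgc (by simp)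
  obtain ⟨B, hB⟩ := hgc.exists_bound_of_continuous hg.continuous
  -- Dividing `g` by `R` makes it an admissible test function: `1`-Lipschitz and bounded by `1`.
  set R : ℝ := A + |B| + 1 with hR
  have hR0 : 0 < R := by positivity
  have hAR : (A : ℝ) ≤ R := by rw [hR]; linarith [abs_nonneg B]
  have hBR : B ≤ R := by rw [hR]; linarith [le_abs_self B, A.coe_nonneg]
  have hlip : LipschitzWith 1 fun x => R⁻¹ * g x := by
    refine LipschitzWith.of_dist_le_mul fun x y => ?_
    rw [Real.dist_eq, ← mul_sub, abs_mul, abs_of_pos (inv_pos.2 hR0), inv_mul_le_iff₀ hR0]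
    have := hA.dist_le_mul x y
    rw [Real.dist_eq] at this
    exact this.trans (by
      rw [NNReal.coe_one, one_mul]
      exact mul_le_mul_of_nonneg_right hAR dist_nonneg)
  have hbd : ∀ x, |R⁻¹ * g x| ≤ 1 := fun x => by
    rw [abs_mul, abs_of_pos (inv_pos.2 hR0), inv_mul_le_iff₀ hR0, mul_one]
    exact (hB x).trans hBR
  have hgi : IntegrableOn g Ω := (hg.continuous.integrable_of_hasCompactSupport hgc).integrableOn
  have hd : ∫ x in Ω, ‖φ x - g x‖ ≤ η / 2 / K := by
    have he := integral_norm_eq_lintegral_enorm (hφ.sub hgi).aestronglyMeasurable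
    simp only [Pi.sub_apply] at he
    rw [he]
    refine ENNReal.toReal_le_of_le_ofReal (by positivity) ?_
    rw [eLpNorm_one_eq_lintegral_enorm] at hφg
    exact hφg
  have hsmall : ∀ᶠ j in atTop, R * ε j < η / 2 := by
    have := hε.const_mul R
    rw [mul_zero] at this
    exact this.eventually_lt_const (by positivity)
  obtain ⟨N, hN⟩ := eventually_atTop.1 hsmall
  refine ⟨N, fun j hj => ?_⟩
  have hbound : ∀ᵐ x ∂(volume.restrict Ω), ‖V j x - F x‖ ≤ K := by
    filter_upwards [hVC j, hFM] with x h1 h2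
    have := norm_sub_le (V j x) (F x)
    rw [hK]
    linarith [le_abs_self (C + M)]
  have hm : AEStronglyMeasurable (fun x => V j x - F x) (volume.restrict Ω) := (hV j).sub hF
  have hsmul : ∀ {ψ : E3 → ℝ} {W : E3 → State} {B : ℝ}, IntegrableOn ψ Ω →
      AEStronglyMeasurable W (volume.restrict Ω) → (∀ᵐ x ∂(volume.restrict Ω), ‖W x‖ ≤ B) →
      IntegrableOn (fun x => ψ x • W x) Ω := fun hψ hW hB =>
    hψ.smul_of_top_left (memLp_top_of_bound hW _ hB)
  have hsplit : (∫ x in Ω, φ x • V j x) - ∫ x in Ω, φ x • F x =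
      (∫ x in Ω, (φ x - g x) • (V j x - F x)) + ∫ x in Ω, g x • (V j x - F x) := by
    rw [← integral_sub (hsmul hφ (hV j) (hVC j)) (hsmul hφ hF hFM),
      ← integral_add (hsmul (ψ := fun x => φ x - g x) (hφ.sub hgi) hm hbound)
        (hsmul hgi hm hbound)]
    congr 1
    ext1 x
    module
  have e1 : ‖∫ x in Ω, (φ x - g x) • (V j x - F x)‖ ≤ η / 2 := by
    refine (norm_integral_le_of_norm_le ((hφ.sub hgi).norm.mul_const K) ?_).trans ?_
    · filter_upwards [hbound] with x hx
      rw [norm_smul]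
      exact mul_le_mul_of_nonneg_left hx (norm_nonneg _)
    · rw [integral_mul_const]
      exact (le_div_iff₀ hK0).1 hd
  have e2 : ‖∫ x in Ω, g x • (V j x - F x)‖ ≤ R * ε j := by
    have h1 := h j _ hlip hbd
    simp_rw [mul_smul] at h1
    rw [integral_smul, norm_smul, norm_inv, Real.norm_eq_abs, abs_of_pos hR0,
      inv_mul_le_iff₀ hR0] at h1
    exact h1
  rw [dist_eq_norm, hsplit]
  have := norm_add_le (∫ x in Ω, (φ x - g x) • (V j x - F x)) (∫ x in Ω, g x • (V j x - F x))
  have := hN j hj.le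
  linarith

/-! ### Conclusion. -/

theorem theorem1p1 (Ω : Set E3) (hΩ_open : IsOpen Ω) (hΩ_bdd : Bornology.IsBounded Ω)
    (hΩ_lip : HasLipschitzBoundary Ω)
    (L : Set State) (hL : IsCompact L) (hL_int : L ⊆ interior (convexHull ℝ bornInfeld))
    (F : E3 → State) (hF : MemLp F ⊤ (volume.restrict Ω))
    (hF_pc : PiecewiseConstantOn F Ω)
    (hF_L : ∀ᵐ x ∂(volume.restrict Ω), F x ∈ L)
    (hF_D : DivFreeOn (fun x => (F x).D) Ω)
    (hF_B : DivFreeOn (fun x => (F x).B) Ω) :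
    ∃ V : ℕ → E3 → State,
      (∀ j, MemLp (V j) ⊤ (volume.restrict Ω) ∧
        DivFreeOn (fun x => (V j x).D) Ω ∧
        DivFreeOn (fun x => (V j x).B) Ω ∧
        ∀ᵐ x ∂(volume.restrict Ω), V j x ∈ bornInfeld) ∧
      WeakStarTendsto V F Ω := by
  obtain ⟨r, hr⟩ := exists_subset_convexHull_image_closedBall hL hL_int
  obtain ⟨C, hC⟩ := exists_norm_toBornInfeld_le (5 * |r|)
  obtain ⟨M, hM⟩ := hL.isBounded.exists_norm_le
  obtain ⟨A, hA, hAd, hAc, hconst⟩ := hF_pc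
  choose c hc using hconst
  have hLapp : L ⊆ approximable |r| C := hr.trans <| (convexHull_mono (image_mono
    (Metric.closedBall_subset_closedBall (le_abs_self r)))).trans
      (convexHull_subset_approximable hC)
  have hcL : ∀ i, (A i).Nonempty → c i ∈ L := by
    intro i hi
    -- Positive measure provides a point where both `F = c i` and `F ∈ L` hold.
    have hpos : volume (A i) ≠ 0 := ((hA i).1.measure_pos volume hi).ne'
    have : (ae (volume.restrict (A i))).NeBot := ae_neBot.2 fun h0 =>
      hpos (Measure.restrict_eq_zero.1 h0)
    obtain ⟨x, hx, hx'⟩ := ((hc i).and (ae_restrict_of_ae_restrict_of_subset (hA i).2.1 hF_L)).exists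
    exact hx ▸ hx'
  have happ : ∀ (ε : ℝ), 0 < ε → ∀ i, ∃ V, IsApprox C (ε / 2 / 2 ^ i) (c i) (A i) V := by
    intro ε hε i
    rcases (A i).eq_empty_or_nonempty with h0 | hi
    · rw [h0]
      exact ⟨_, isApprox_empty (by positivity) (toBornInfeld_mem 0)
        (hC 0 (by rw [norm_zero]; positivity)) _⟩
    · exact (hLapp (hcL i hi)).2.2 (A i) (hA i).1 (hΩ_bdd.subset (hA i).2.1) _ (by positivity)
  have hFM : ∀ᵐ x ∂(volume.restrict Ω), ‖F x‖ ≤ M := hF_L.mono fun x hx => hM _ hx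
  choose V hVm hVC hVmem hVD hVB hVφ using fun j : ℕ => exists_glue hΩ_bdd
    hF.aestronglyMeasurable hFM (fun i => (hA i).1) (fun i => (hA i).2.1) (fun i j => hAd i j)
    hAc hc (happ (1 / ((j : ℝ) + 1)) (by positivity)) hF_D hF_B
  exact ⟨V, fun j => ⟨memLp_top_of_bound (hVm j).aestronglyMeasurable C (hVC j), hVD j, hVB j,
    hVmem j⟩, weakStarTendsto_of_lipschitz (fun j => (hVm j).aestronglyMeasurable)
      hF.aestronglyMeasurable hVC hFM tendsto_one_div_add_atTop_nhds_zero_nat hVφ⟩
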